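/- **Setting.** *Logic.* Worlds over a finite alphabet $\mathfrak P$ are identified with truth value assignments $\omega:\mathfrak P\to\{\text{True},\text{False}\}$, and a formula $\varphi$ with the event $\{\omega:\omega\models\varphi\}$. Conditional probabilities given an event of probability $0$ are $0$. A (literal) causal rule $\varphi\Rightarrow l$ has a formula $\varphi$ as cause (e.g. a conjunction of literals) and a literal $l$ as effect. For a set $\Delta$ of rules, $\Rrightarrow_\Delta$ is the smallest binary relation on formulas that contains $\Delta$, satisfies $\top\Rrightarrow\top$ and $\bot\Rrightarrow\bot$, and is closed under: Strengthening ($\varphi\vdash\psi$, $\psi\Rrightarrow\rho$ give $\varphi\Rrightarrow\rho$), Weakening ($\varphi\Rrightarrow\psi$, $\psi\vdash\rho$ give $\varphi\Rrightarrow\rho$), And ($\varphi\Rrightarrow\psi$, $\varphi\Rrightarrow\rho$ give $\varphi\Rrightarrow\psi\wedge\rho$), Cut ($\varphi\Rrightarrow\psi$, $\varphi\wedge\psi\Rrightarrow\rho$ give $\varphi\Rrightarrow\rho$), Or ($\varphi\Rrightarrow\rho$, $\psi\Rrightarrow\rho$ give $\varphi\vee\psi\Rrightarrow\rho$). For a set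 $\mathcal E$ of literals and a world $\omega$, let $\mathcal C_\omega$ be the set of formulas $\psi$ with $\bigwedge L\Rrightarrow_{\Delta'}\psi$ for some finite set $L$ of literals in $\mathcal E$ that hold in $\omega$, where $\Delta':=\{(\varphi\Rightarrow l)\in\Delta:\omega\models\varphi\to l\}\cup\{l\Rightarrow l: l\in\mathcal E\}$. The event $\mathrm{suff}(\Delta,\mathcal E)$ consists of the worlds $\omega$ such that for every literal $l$ of the alphabet of $(\Delta,\mathcal E)$, $l\in\mathcal C_\omega$ or $\neg l\in\mathcal C_\omega$. *LogLinear models.* A LogLinear model $\Phi$ is a finite set of pairs $(w,\varphi)$ with $w\in\mathbb R\cup\{\pm\infty\}$ and $\varphi$ a formula. The weight of $\omega$ is $\prod_{(w,\varphi)\in\Phi,\,w\in\mathbb R,\,\omega\models\varphi}e^{w}$ if $\omega\models\varphi$ for all $(+\infty,\varphi)\in\Phi$ and $\omega\models\neg\varphi$ for all $(-\infty,\varphi)\in\Phi$, and $0$ otherwise; $\pi_\Phi$ is the normalized weight. *Maximum entropy causal systems.* Such a system $\mathbf{CS}=(\Theta,\mathcal E,\mathcal O,\Sigma)$ consists of a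 finite set $\Theta$ of weighted causal rules $(w,R)$, $w\in\mathbb R\cup\{\pm\infty\}$, a set $\mathcal E$ of literals, a set $\mathcal O$ of formulas and a LogLinear model $\Sigma$. Put $\mathcal E^{\rm pure}:=\{p: p,\neg p\in\mathcal E\}$. On $\mathfrak P$ draw an edge $p\to q$ if $p$ occurs in the cause of a rule of $\Theta$ with effect $q$ or $\neg q$; let $G$ be the (loop-free) factor graph on strongly connected components. For a component $V$ with $V\cap\mathcal E^{\rm pure}=\emptyset$, let $\Theta|V$ be the set of rules of $\Theta$ with effect $p$ or $\neg p$, $p\in V$, let $\mathrm{con}(\Theta|V):=\{(w,\varphi\to l):(w,\varphi\Rightarrow l)\in\Theta|V\}$, and let $\mathbf{CS}^V$ be the system over the alphabet $V\cup\bigcup\mathrm{Pa}(V)$ whose rules are those of $\Theta|V$ and whose external premises are all literals over $\bigcup\mathrm{Pa}(V)$ together with the literals of $\mathcal E$ over $V$. For assignments $v$ of $V$ and $\mathrm{pa}(V)$ of $\bigcup\mathrm{Pa}(V)$ put $$\pi(v\mid \mathrm{pa}(V)):=\pi_{\mathrm{con}(\Theta|V)}\bigl(v\mid \mathrm{pa}(V),\mathrm{suff}(\mathbf{CS}^V)\bigr).\qquad(*)$$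 $\mathbf{CS}$ *provides demonstrations* if (i) for all such $V$ and $\mathrm{pa}(V)$ the numbers $(*)$ sum to one over $v$; (ii) no rule of $\Theta$ has an effect $p$ or $\neg p$ with $p\in\mathcal E^{\rm pure}$; (iii) every $p\in\mathfrak P$ occurs in the effect of a rule of $\Theta$ or in a literal of $\mathcal E$. In this case let $\mathbf{BN}$ be the Bayesian network obtained from $G$ by merging the components $\{p\}$, $p\in\mathcal E^{\rm pure}$, into one node $\mathcal E^{\rm pure}$, with parameters $\pi_\Sigma(\mathbf s)$ for the values $\mathbf s$ of the node $\mathcal E^{\rm pure}$ and $(*)$ for all other nodes; let $\pi^{\rm causal}_{\mathbf{CS}}(A):=\pi_{\mathbf{BN}}(A\mid\mathcal O)$. Let $\mathbf{CS}|\mathcal E$ be obtained from $\mathbf{CS}$ by keeping only the observations that can be formed with literals in $\mathcal E$. If $\mathbf{CS}$ provides demonstrations and $\pi^{\rm causal}_{\mathbf{CS}}(A)=\pi^{\rm causal}_{\mathbf{CS}|\mathcal E}(A)$, then $\mathbf{CS}$ *assumes knowledge-why* that $A$ occurs with probability $\pi^{\rm why}_{\mathbf{CS}}(A):=\pi^{\rm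 causal}_{\mathbf{CS}}(A)$. *Causal models.* A probabilistic Boolean causal model $\mathbb M$ consists of finite sets $\mathbf U$ of external and $\mathbf V$ of internal variables, sets $\mathrm{Pa}(X)\subseteq\mathbf V$ and $\mathrm{Error}(X)\subseteq\mathbf U$ and a Boolean function $F_X$ of the values of $\mathrm{Pa}(X)$ and $\mathrm{Error}(X)$ for each $X\in\mathbf V$, and a probability distribution $\pi$ on the situations, i.e. the assignments $\mathbf u$ of $\mathbf U$. It is acyclic if the graph on $\mathbf V$ with edges $Y\to X$ for $Y\in\mathrm{Pa}(X)$ has no directed cycle; then each $\mathbf u$ extends to a unique solution $\mathbf s(\mathbf u)$ of the equations $X=F_X$, and $\pi_{\mathbb M}(\omega):=\pi(\mathbf u)$ if $\omega=\mathbf s(\mathbf u)$, $\pi_{\mathbb M}(\omega):=0$ if $\omega$ is not a solution. Let each $F_X$ be represented by the disjunction of a finite set $D_X$ of formulas in the variables $\mathrm{Pa}(X)\cup\mathrm{Error}(X)$ (for instance one formula, or the conjunctions of a disjunctive normal form). The Bochman transformation $\mathbf{CS}(\mathbb M)=(\Theta,\mathcal E,\emptyset,\Sigma)$ over $\mathfrak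 P=\mathbf U\sqcup\mathbf V$ is given by $\Theta:=\{(+\infty,\varphi\Rightarrow X):X\in\mathbf V,\ \varphi\in D_X\}$, $\mathcal E:=\mathbf U\cup\{\neg p:p\in\mathbf U\cup\mathbf V\}$ and $\Sigma:=\{(\ln\pi(\mathbf u),\bigwedge\mathbf u):\mathbf u\text{ a situation}\}$, where $\ln 0=-\infty$ and $\bigwedge\mathbf u$ is the conjunction of the literals of $\mathbf u$. **Theorem.** Let $\mathbb M$ be an acyclic probabilistic Boolean causal model with Bochman transformation $\mathbf{CS}(\mathbb M)$ (for any choice of the representations $D_X$). Then $\mathbf{CS}(\mathbb M)$ provides demonstrations, and for every formula $\varphi$ over $\mathbf U\sqcup\mathbf V$ it assumes knowledge-why that $\varphi$ occurs with probability $$\pi^{\rm why}_{\mathbf{CS}(\mathbb M)}(\varphi)=\pi_{\mathbb M}(\varphi).$$ -/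

import Mathlib

namespace MaxEnt

universe u v

/-! ### Propositional logic -/

/-- Propositional formulas over the alphabet `P`. -/
inductive Formula (P : Type u) : Type u where
  | atom : P → Formula P
  | top : Formula P
  | bot : Formula P
  | neg : Formula P → Formula P
  | and : Formula P → Formula P → Formula P
  | or : Formula P → Formula P → Formula P
  | imp : Formula P → Formula P → Formula P

/-- A world, identified with the truth value assignment that it determines. -/
abbrev World (P : Type u) : Type u := P → Bool

namespace Formula

variable {P : Type u}

/-- `φ.Sat ω` means `ω ⊨ φ`. -/
def Sat (ω : World P) : Formula P → Prop
  | atom p => ω p = true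
  | top => True
  | bot => False
  | neg φ => ¬ Sat ω φ
  | and φ ψ => Sat ω φ ∧ Sat ω ψ
  | or φ ψ => Sat ω φ ∨ Sat ω ψ
  | imp φ ψ => Sat ω φ → Sat ω ψ

/-- The propositions that occur in a formula. -/
def atoms : Formula P → Set P
  | atom p => {p}
  | top => ∅
  | bot => ∅
  | neg φ => atoms φ
  | and φ ψ => atoms φ ∪ atoms ψ
  | or φ ψ => atoms φ ∪ atoms ψ
  | imp φ ψ => atoms φ ∪ atoms ψ

/-- The event given by a formula. -/
def event (φ : Formula P) : Set (World P) := {ω | Sat ω φ}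

/-- Entailment (equivalently, by completeness, derivability) between formulas. -/
def Entails (φ ψ : Formula P) : Prop := ∀ ω : World P, Sat ω φ → Sat ω ψ

/-- Conjunction of a finite list of formulas. -/
def conj : List (Formula P) → Formula P
  | [] => top
  | φ :: l => and φ (conj l)

end Formula

/-- A literal: `⟨p, true⟩` is `p` and `⟨p, false⟩` is `¬ p`. -/
structure Literal (P : Type u) : Type u where
  prop : P
  sign : Bool

namespace Literal

variable {P : Type u}

def toFormula (l : Literal P) : Formula P :=
  if l.sign then Formula.atom l.prop else Formula.neg (Formula.atom l.prop)

/-- The literal `l` is true in (belongs to) the world `ω`. -/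
def Holds (ω : World P) (l : Literal P) : Prop := ω l.prop = l.sign

end Literal

/-! ### Causal rules, causal production inference, deterministic causal systems -/

/-- A causal rule `cause ⇒ effect`. -/
structure Rule (P : Type u) : Type u where
  cause : Formula P
  effect : Formula P

/-- The constraint content `φ → ψ` of a causal rule `φ ⇒ ψ`. -/
def Rule.constraint {P : Type u} (R : Rule P) : Formula P := Formula.imp R.cause R.effect

/-- The smallest causal production inference relation that contains the causal theory `Δ`. -/
inductive Produces {P : Type u} (Δ : Set (Rule P)) : Formula P → Formula P → Prop where
  | rule (R : Rule P) : R ∈ Δ → Produces Δ R.cause R.effect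
  | strengthening (φ ψ ρ : Formula P) : φ.Entails ψ → Produces Δ ψ ρ → Produces Δ φ ρ
  | weakening (φ ψ ρ : Formula P) : Produces Δ φ ψ → ψ.Entails ρ → Produces Δ φ ρ
  | and (φ ψ ρ : Formula P) : Produces Δ φ ψ → Produces Δ φ ρ → Produces Δ φ (ψ.and ρ)
  | truth : Produces Δ Formula.top Formula.top
  | falsity : Produces Δ Formula.bot Formula.bot
  | cut (φ ψ ρ : Formula P) : Produces Δ φ ψ → Produces Δ (φ.and ψ) ρ → Produces Δ φ ρ
  | or (φ ψ ρ : Formula P) : Produces Δ φ ρ → Produces Δ ψ ρ → Produces Δ (φ.or ψ) ρ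

/-- The consequence operator `C` of the causal theory `Δ`. -/
def consequences {P : Type u} (Δ : Set (Rule P)) (Φ : Set (Formula P)) : Set (Formula P) :=
  {ψ | ∃ l : List (Formula P), (∀ φ ∈ l, φ ∈ Φ) ∧ Produces Δ (Formula.conj l) ψ}

/-- A causal rule with a literal as effect. The cause may be any formula; a conjunction of
literals is a special case. -/
structure LiteralRule (P : Type u) : Type u where
  cause : Formula P
  effect : Literal P

def LiteralRule.toRule {P : Type u} (R : LiteralRule P) : Rule P :=
  ⟨R.cause, R.effect.toFormula⟩

/-- A deterministic causal system `(Δ, E, O)`. -/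
structure DetSystem (P : Type u) : Type u where
  knowledge : Set (LiteralRule P)
  premises : Set (Literal P)
  observations : Set (Formula P)

namespace DetSystem

variable {P : Type u} (CS : DetSystem P)

/-- The explanatory closure `Δ ∪ {l ⇒ l | l ∈ E}`. -/
def closure : Set (Rule P) :=
  LiteralRule.toRule '' CS.knowledge ∪ {R | ∃ l ∈ CS.premises, R = ⟨l.toFormula, l.toFormula⟩}

/-- The explanatory content `(Δ|ω, E, ∅)` for a world `ω`; `Δ|ω` consists of the rules
whose constraint content holds in `ω`. -/
def content (ω : World P) : DetSystem P where
  knowledge := {R ∈ CS.knowledge | R.toRule.constraint.Sat ω}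
  premises := CS.premises
  observations := ∅

/-- The external premises that hold in `ω`, as formulas (`ω ∩ E`). -/
def premisesIn (ω : World P) : Set (Formula P) :=
  Literal.toFormula '' {l ∈ CS.premises | l.Holds ω}

/-- The formula `φ` is explainable in `ω`. -/
def Explains (ω : World P) (φ : Formula P) : Prop :=
  φ ∈ consequences (CS.content ω).closure (CS.premisesIn ω) ∨
    φ.neg ∈ consequences (CS.content ω).closure (CS.premisesIn ω)

/-- The event that `CS`, regarded as a system over the alphabet `A`, is causally sufficient:
all literals over `A` are explainable. -/
def sufficient (A : Set P) : Set (World P) :=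
  {ω | ∀ l : Literal P, l.prop ∈ A → CS.Explains ω l.toFormula}

end DetSystem

/-! ### LogLinear models -/

/-- A LogLinear model: a finite set of weighted constraints. -/
abbrev LogLinear (P : Type u) : Type u := Finset (EReal × Formula P)

namespace LogLinear

variable {P : Type u}

/-- `ω` satisfies all hard constraints. -/
def Possible (Φ : LogLinear P) (ω : World P) : Prop :=
  ∀ c ∈ Φ, (c.1 = ⊤ → c.2.Sat ω) ∧ (c.1 = ⊥ → ¬ c.2.Sat ω)

open Classical in
/-- The weight of a world. -/
noncomputable def weight (Φ : LogLinear P) (ω : World P) : ℝ :=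
  if Φ.Possible ω then
    ∏ c ∈ Φ with c.1 ≠ ⊤ ∧ c.1 ≠ ⊥ ∧ c.2.Sat ω, Real.exp c.1.toReal
  else 0

open Classical in
/-- The weight of an event. -/
noncomputable def eventWeight [Fintype P] (Φ : LogLinear P) (A : Set (World P)) : ℝ :=
  ∑ ω with ω ∈ A, Φ.weight ω

/-- The probability of an event. -/
noncomputable def prob [Fintype P] (Φ : LogLinear P) (A : Set (World P)) : ℝ :=
  Φ.eventWeight A / Φ.eventWeight Set.univ

theorem weight_nonneg (Φ : LogLinear P) (ω : World P) : 0 ≤ Φ.weight ω := by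
  unfold weight
  split_ifs
  · exact Finset.prod_nonneg fun _ _ => (Real.exp_pos _).le
  · exact le_rfl

theorem eventWeight_nonneg [Fintype P] (Φ : LogLinear P) (A : Set (World P)) :
    0 ≤ Φ.eventWeight A :=
  Finset.sum_nonneg fun _ _ => Φ.weight_nonneg _

theorem eventWeight_mono [Fintype P] (Φ : LogLinear P) {A B : Set (World P)} (h : A ⊆ B) :
    Φ.eventWeight A ≤ Φ.eventWeight B := by
  unfold eventWeight
  refine Finset.sum_le_sum_of_subset_of_nonneg ?_ fun _ _ _ => Φ.weight_nonneg _
  intro ω hω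
  simp only [Finset.mem_filter, Finset.mem_univ, true_and] at hω ⊢
  exact h hω

theorem prob_nonneg [Fintype P] (Φ : LogLinear P) (A : Set (World P)) : 0 ≤ Φ.prob A :=
  div_nonneg (Φ.eventWeight_nonneg _) (Φ.eventWeight_nonneg _)

theorem prob_mono [Fintype P] (Φ : LogLinear P) {A B : Set (World P)} (h : A ⊆ B) :
    Φ.prob A ≤ Φ.prob B :=
  div_le_div_of_nonneg_right (Φ.eventWeight_mono h) (Φ.eventWeight_nonneg _)

theorem prob_le_one [Fintype P] (Φ : LogLinear P) (A : Set (World P)) : Φ.prob A ≤ 1 :=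
  div_le_one_of_le₀ (Φ.eventWeight_mono (Set.subset_univ A)) (Φ.eventWeight_nonneg _)

/-- Conditional probability, which is `0` if the condition has probability `0`. -/
noncomputable def condProb [Fintype P] (Φ : LogLinear P) (A B : Set (World P)) : ℝ :=
  Φ.prob (A ∩ B) / Φ.prob B

end LogLinear

/-- The event that the propositions in `V` take the values given by `v`. -/
def assign {P : Type u} (V : Set P) (v : V → Bool) : Set (World P) := {ω | ∀ p : V, ω p = v p}

/-! ### Bayesian networks -/

/-- The union of the parents of `V` in a graph whose nodes are blocks of propositions. -/
def parentSet {P : Type u} (nodes : Set (Set P)) (edge : Set P → Set P → Prop) (V : Set P) :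
    Set P :=
  {p | ∃ W ∈ nodes, edge W V ∧ p ∈ W}

/-- A Bayesian network whose random variables are blocks `V` of propositions, the values of `V`
being the truth value assignments on `V`. The value `param V v pa` is the probability of the
value `v` of `V` if the parents of `V` have the values `pa`. -/
structure BayesianNetwork (P : Type u) [Fintype P] : Type u where
  nodes : Finset (Set P)
  edge : Set P → Set P → Prop
  acyclic : ∀ V, ¬ Relation.TransGen (fun A B => A ∈ nodes ∧ B ∈ nodes ∧ edge A B) V V
  param : (V : Set P) → (V → Bool) → (parentSet (nodes : Set (Set P)) edge V → Bool) → ℝ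
  param_nonneg : ∀ V v pa, 0 ≤ param V v pa
  param_le_one : ∀ V v pa, param V v pa ≤ 1

namespace BayesianNetwork

variable {P : Type u} [Fintype P]

/-- The probability of a world, i.e. of a value assignment to all variables. -/
noncomputable def worldProb (BN : BayesianNetwork P) (ω : World P) : ℝ :=
  ∏ V ∈ BN.nodes, BN.param V (fun p => ω p) (fun p => ω p)

open Classical in
noncomputable def prob (BN : BayesianNetwork P) (A : Set (World P)) : ℝ :=
  ∑ ω with ω ∈ A, BN.worldProb ω

noncomputable def condProb (BN : BayesianNetwork P) (A B : Set (World P)) : ℝ :=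
  BN.prob (A ∩ B) / BN.prob B

end BayesianNetwork

/-! ### Maximum entropy causal systems -/

/-- A weighted causal theory. -/
abbrev WeightedTheory (P : Type u) : Type u := Finset (EReal × LiteralRule P)

open Classical in
/-- The constraint content of a weighted causal theory. -/
noncomputable def WeightedTheory.constraint {P : Type u} (Θ : WeightedTheory P) : LogLinear P :=
  Θ.image fun r => (r.1, r.2.toRule.constraint)

/-- The explanatory content of a weighted causal theory. -/
def WeightedTheory.explanatory {P : Type u} (Θ : WeightedTheory P) : Set (LiteralRule P) :=
  {R | ∃ w, (w, R) ∈ Θ}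

/-- `FormedFrom E s φ`: in negation normal form, `φ` (if `s = true`), respectively `¬ φ`
(if `s = false`), only uses literals in `E`. -/
def FormedFrom {P : Type u} (E : Set (Literal P)) : Bool → Formula P → Prop
  | s, .atom p => ⟨p, s⟩ ∈ E
  | _, .top => True
  | _, .bot => True
  | s, .neg φ => FormedFrom E (!s) φ
  | s, .and φ ψ => FormedFrom E s φ ∧ FormedFrom E s ψ
  | s, .or φ ψ => FormedFrom E s φ ∧ FormedFrom E s ψ
  | s, .imp φ ψ => FormedFrom E (!s) φ ∧ FormedFrom E s ψ

/-- A maximum entropy causal system `(Θ, E, O, Σ)`. -/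
structure CausalSystem (P : Type u) : Type u where
  knowledge : WeightedTheory P
  premises : Set (Literal P)
  observations : Set (Formula P)
  science : LogLinear P

namespace CausalSystem

variable {P : Type u} (CS : CausalSystem P)

/-- The pure external premises. -/
def pure : Set P := {p | ⟨p, true⟩ ∈ CS.premises ∧ ⟨p, false⟩ ∈ CS.premises}

/-- The edges of the causal structure of the explanatory content, on propositions. -/
def propEdge (p q : P) : Prop :=
  ∃ R ∈ CS.knowledge.explanatory, p ∈ R.cause.atoms ∧ R.effect.prop = q

/-- There is a directed path from `p` to `q`. -/
def Reach : P → P → Prop := Relation.ReflTransGen CS.propEdge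

/-- The strongly connected component of `p`. -/
def component (p : P) : Set P := {q | CS.Reach p q ∧ CS.Reach q p}

/-- The set of strongly connected components, i.e. of nodes of the factor graph. -/
def components : Set (Set P) := Set.range CS.component

/-- The edges of the factor graph (which is acyclic, hence without loops). -/
def blockEdge (V W : Set P) : Prop := V ≠ W ∧ ∃ p ∈ V, ∃ q ∈ W, CS.propEdge p q

/-- The propositions in the parents of `V` in the factor graph. -/
def parents (V : Set P) : Set P := parentSet CS.components CS.blockEdge V

open Classical in
/-- `Θ|V`: the weighted rules with effect in `V`. -/
noncomputable def rulesFor (V : Set P) : WeightedTheory P :=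
  CS.knowledge.filter fun r => r.2.effect.prop ∈ V

/-- The local system of `V`: its rules are those with effect in `V`; its external premises are
all literals over the parents of `V` and the external premises of `CS` over `V` itself. -/
noncomputable def localSystem (V : Set P) : DetSystem P where
  knowledge := (CS.rulesFor V).explanatory
  premises := {l | l.prop ∈ CS.parents V} ∪ {l ∈ CS.premises | l.prop ∈ V}
  observations := ∅

variable [Fintype P]

/-- The probability that there is a demonstration of the value `v` of the component `V` from the
value `pa` of its parents. The alphabet of the local system consists of the propositions in `V`
and in its parents. -/
noncomputable def demoProb (V : Set P) (v : V → Bool) (pa : CS.parents V → Bool) : ℝ :=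
  (CS.rulesFor V).constraint.condProb (assign V v)
    (assign (CS.parents V) pa ∩ (CS.localSystem V).sufficient (V ∪ CS.parents V))

open Classical in
/-- The system provides demonstrations. -/
structure ProvidesDemonstrations : Prop where
  sum_eq_one : ∀ V ∈ CS.components, Disjoint V CS.pure → ∀ pa : CS.parents V → Bool,
    ∑ v : V → Bool, CS.demoProb V v pa = 1
  pure_not_effect : ∀ R ∈ CS.knowledge.explanatory, R.effect.prop ∉ CS.pure
  covered : ∀ p : P, (∃ R ∈ CS.knowledge.explanatory, R.effect.prop = p) ∨
    ∃ l ∈ CS.premises, l.prop = p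

open Classical in
/-- The nodes of the causal structure of `CS`: the pure external premises are merged into a
single node. -/
noncomputable def nodes : Finset (Set P) :=
  insert CS.pure (Finset.univ.filter fun V => V ∈ CS.components ∧ Disjoint V CS.pure)

namespace ProvidesDemonstrations

variable {CS}

theorem not_edge_pure (h : CS.ProvidesDemonstrations) {p q : P} (e : CS.propEdge p q) :
    q ∉ CS.pure := by
  obtain ⟨R, hR, -, rfl⟩ := e
  exact h.pure_not_effect R hR

theorem eq_of_reach_pure (h : CS.ProvidesDemonstrations) {p q : P} (r : CS.Reach p q)
    (hq : q ∈ CS.pure) : p = q := by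
  rcases Relation.ReflTransGen.cases_tail r with r | ⟨c, -, e⟩
  · exact r.symm
  · exact absurd hq (h.not_edge_pure e)

theorem component_pure (h : CS.ProvidesDemonstrations) {V : Set P} (hV : V ∈ CS.components)
    {p : P} (hp : p ∈ V) (hpp : p ∈ CS.pure) {q : P} (hq : q ∈ V) : q = p := by
  obtain ⟨a, rfl⟩ := hV
  exact h.eq_of_reach_pure (hq.2.trans hp.1) hpp

theorem parents_subset (h : CS.ProvidesDemonstrations) {V : Set P} (hV : V ≠ CS.pure) :
    CS.parents V ⊆ parentSet (CS.nodes : Set (Set P)) CS.blockEdge V := by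
  rintro p ⟨W, hW, ⟨hne, a, ha, b, hb, e⟩, hp⟩
  by_cases hpp : p ∈ CS.pure
  · have hap := h.component_pure hW hp hpp ha
    subst hap
    exact ⟨CS.pure, by simp [nodes], ⟨hV.symm, a, hpp, b, hb, e⟩, hpp⟩
  · refine ⟨W, ?_, ⟨hne, a, ha, b, hb, e⟩, hp⟩
    have hd : Disjoint W CS.pure := by
      rw [Set.disjoint_left]
      intro q hq hqp
      exact hpp (h.component_pure hW hq hqp hp ▸ hqp)
    simp [nodes, hW, hd]

theorem acyclic (h : CS.ProvidesDemonstrations) (V : Set P) :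
    ¬ Relation.TransGen (fun A B => A ∈ CS.nodes ∧ B ∈ CS.nodes ∧ CS.blockEdge A B) V V := by
  set E : Set P → Set P → Prop := fun A B => A ∈ CS.nodes ∧ B ∈ CS.nodes ∧ CS.blockEdge A B
    with hE
  have target : ∀ {A B}, E A B → B ∈ CS.components := by
    rintro A B ⟨-, hB, -, p, -, q, hq, e⟩
    have hne : B ≠ CS.pure := by
      rintro rfl
      exact h.not_edge_pure e hq
    simp only [nodes, Finset.mem_insert, hne, false_or, Finset.mem_filter, Finset.mem_univ,
      true_and] at hB
    exact hB.1
  have inner : ∀ {A : Set P}, A ∈ CS.components → ∀ {a b}, a ∈ A → b ∈ A → CS.Reach a b := by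
    rintro A ⟨c, rfl⟩ a b ha hb
    exact ha.2.trans hb.1
  have step : ∀ {A B}, A ∈ CS.components → E A B → ∀ {a b}, a ∈ A → b ∈ B → CS.Reach a b := by
    intro A B hA hAB a b ha hb
    have hB := target hAB
    obtain ⟨-, -, -, p, hp, q, hq, e⟩ := hAB
    exact ((inner hA ha hp).tail e).trans (inner hB hq hb)
  have path : ∀ {A B}, Relation.ReflTransGen E A B → A ∈ CS.components →
      B ∈ CS.components ∧ ∀ {a b}, a ∈ A → b ∈ B → CS.Reach a b := by
    intro A B r hA
    induction r with
    | refl => exact ⟨hA, fun ha hb => inner hA ha hb⟩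
    | tail r e ih =>
      refine ⟨target e, fun ha hb => ?_⟩
      obtain ⟨p, hp⟩ : ∃ p, p ∈ _ := ⟨_, e.2.2.2.choose_spec.1⟩
      exact (ih.2 ha hp).trans (step ih.1 e hp hb)
  intro hVV
  obtain ⟨W, hVW, hWV⟩ := Relation.TransGen.head'_iff.1 hVV
  have hW := target hVW
  obtain ⟨hV, back⟩ := path hWV hW
  apply hVW.2.2.1
  obtain ⟨p, rfl⟩ := hV
  obtain ⟨q, rfl⟩ := hW
  have hp : p ∈ CS.component p := ⟨.refl, .refl⟩
  have hq : q ∈ CS.component q := ⟨.refl, .refl⟩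
  have hpq := step ⟨p, rfl⟩ hVW hp hq
  have hqp := back hq hp
  ext x
  exact ⟨fun hx => ⟨hqp.trans hx.1, hx.2.trans hpq⟩, fun hx => ⟨hpq.trans hx.1, hx.2.trans hqp⟩⟩

open Classical in
/-- The Bayesian network of a system that provides demonstrations: the situation `S` (the value
of the merged node) has its probability in the superordinate science, every other node has the
demonstration probabilities as parameters. -/
noncomputable def network (h : CS.ProvidesDemonstrations) : BayesianNetwork P where
  nodes := CS.nodes
  edge := CS.blockEdge
  acyclic := h.acyclic
  param V v pa :=
    if hV : V = CS.pure then CS.science.prob (assign V v)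
    else CS.demoProb V v fun p => pa ⟨p, h.parents_subset hV p.2⟩
  param_nonneg V v pa := by
    split_ifs
    · exact LogLinear.prob_nonneg _ _
    · exact div_nonneg (LogLinear.prob_nonneg _ _) (LogLinear.prob_nonneg _ _)
  param_le_one V v pa := by
    split_ifs
    · exact LogLinear.prob_le_one _ _
    · exact div_le_one_of_le₀ (LogLinear.prob_mono _ Set.inter_subset_right)
        (LogLinear.prob_nonneg _ _)

/-- The causal semantics: the distribution of the network, conditioned on the observations. -/
noncomputable def causalProb (h : CS.ProvidesDemonstrations) (A : Set (World P)) : ℝ :=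
  h.network.condProb A {ω | ∀ o ∈ CS.observations, o.Sat ω}

end ProvidesDemonstrations

/-- The system in which only those observations are kept that can be formed with the external
premises. -/
def restrict : CausalSystem P :=
  { CS with observations := {o ∈ CS.observations | FormedFrom CS.premises true o} }

theorem ProvidesDemonstrations.restrict {CS : CausalSystem P} (h : CS.ProvidesDemonstrations) :
    CS.restrict.ProvidesDemonstrations :=
  ⟨h.sum_eq_one, h.pure_not_effect, h.covered⟩

/-- The system provides demonstrations and assumes knowledge-why that the event `A` occurs with
probability `x`. -/
def KnowsWhy (A : Set (World P)) (x : ℝ) : Prop :=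
  ∃ h : CS.ProvidesDemonstrations,
    h.causalProb A = h.restrict.causalProb A ∧ h.causalProb A = x

end CausalSystem

/-! ### Probabilistic causal models and their Bochman transformation -/

/-- A Boolean structural causal model with external variables `U` and internal variables `V`. -/
structure CausalModel (U : Type u) (V : Type v) : Type (max u v) where
  error : V → Set U
  pa : V → Set V
  F : (x : V) → (pa x → Bool) → (error x → Bool) → Bool

namespace CausalModel

variable {U : Type u} {V : Type v} (M : CausalModel U V)

/-- The causal diagram has no directed cycles. -/
def Acyclic : Prop := ∀ x : V, ¬ Relation.TransGen (fun y z => y ∈ M.pa z) x x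

/-- The value assignment `ω` satisfies all structural equations. -/
def IsSolution (ω : World (U ⊕ V)) : Prop :=
  ∀ x : V, ω (Sum.inr x) = M.F x (fun y => ω (Sum.inr y)) (fun e => ω (Sum.inl e))

/-- A presentation of the functions `F` by propositional formulas: for each internal variable
`x` a finite set of formulas in the parents and error terms of `x` whose disjunction represents
`F x`. It may be a single formula, or the conjunctions of a disjunctive normal form. -/
structure Presentation : Type (max u v) where
  causes : V → Finset (Formula (U ⊕ V))
  atoms_subset : ∀ x, ∀ φ ∈ causes x, φ.atoms ⊆ Sum.inl '' M.error x ∪ Sum.inr '' M.pa x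
  represents : ∀ x (ω : World (U ⊕ V)), (∃ φ ∈ causes x, φ.Sat ω) ↔
    M.F x (fun y => ω (Sum.inr y)) (fun e => ω (Sum.inl e)) = true

/-- Every causal model has a presentation, by full disjunctive normal forms. -/
theorem Presentation.nonempty [Fintype U] [Fintype V] : Nonempty M.Presentation := by
  classical
  let A : V → Set (U ⊕ V) := fun x => Sum.inl '' M.error x ∪ Sum.inr '' M.pa x
  let lits : V → World (U ⊕ V) → List (Formula (U ⊕ V)) := fun x a =>
    ((Finset.univ.filter fun p => p ∈ A x).toList).map fun p =>
      (⟨p, a p⟩ : Literal (U ⊕ V)).toFormula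
  have hsat : ∀ (ω : World (U ⊕ V)) (l : List (Formula (U ⊕ V))),
      (Formula.conj l).Sat ω ↔ ∀ φ ∈ l, φ.Sat ω := by
    intro ω l
    induction l with
    | nil => simp [Formula.conj, Formula.Sat]
    | cons φ l ih => simp [Formula.conj, Formula.Sat, ih]
  have hat : ∀ (l : List (Formula (U ⊕ V))) (B : Set (U ⊕ V)), (∀ φ ∈ l, φ.atoms ⊆ B) →
      (Formula.conj l).atoms ⊆ B := by
    intro l B h
    induction l with
    | nil => simp [Formula.conj, Formula.atoms]
    | cons φ l ih =>
      simp only [List.mem_cons, forall_eq_or_imp] at h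
      exact Set.union_subset h.1 (ih h.2)
  have hlit : ∀ (ω : World (U ⊕ V)) (l : Literal (U ⊕ V)),
      l.toFormula.Sat ω ↔ ω l.prop = l.sign := by
    rintro ω ⟨p, s⟩
    cases s <;> simp [Literal.toFormula, Formula.Sat]
  have hmin : ∀ (ω a : World (U ⊕ V)) (x : V),
      (Formula.conj (lits x a)).Sat ω ↔ ∀ p ∈ A x, ω p = a p := by
    intro ω a x
    rw [hsat]
    constructor
    · intro h p hp
      exact (hlit ω _).1 (h _ (List.mem_map.2 ⟨p, by simpa only [Finset.mem_toList,
        Finset.mem_filter, Finset.mem_univ, true_and] using hp, rfl⟩))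
    · intro h φ hφ
      obtain ⟨p, hp, rfl⟩ := List.mem_map.1 hφ
      exact (hlit ω _).2 (h p (by simpa only [Finset.mem_toList,
        Finset.mem_filter, Finset.mem_univ, true_and] using hp))
  refine ⟨⟨fun x => (Finset.univ.filter fun a : World (U ⊕ V) =>
    M.F x (fun y => a (Sum.inr y)) (fun e => a (Sum.inl e)) = true).image
      fun a => Formula.conj (lits x a), ?_, ?_⟩⟩
  · intro x φ hφ
    obtain ⟨a, -, rfl⟩ := Finset.mem_image.1 hφ
    apply hat
    intro ψ hψ
    obtain ⟨p, hp, rfl⟩ := List.mem_map.1 hψ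
    have hp' : p ∈ A x := by simpa using hp
    have hs : (⟨p, a p⟩ : Literal (U ⊕ V)).toFormula.atoms = {p} := by
      cases h : a p <;> simp [Literal.toFormula, Formula.atoms]
    rw [hs]
    exact Set.singleton_subset_iff.2 hp'
  · intro x ω
    constructor
    · rintro ⟨φ, hφ, hs⟩
      obtain ⟨a, ha, rfl⟩ := Finset.mem_image.1 hφ
      rw [hmin] at hs
      have ha' := (Finset.mem_filter.1 ha).2
      rw [← ha']
      congr 1
      · funext y
        exact hs _ (Or.inr ⟨y, y.2, rfl⟩)
      · funext e
        exact hs _ (Or.inl ⟨e, e.2, rfl⟩)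
    · intro h
      exact ⟨_, Finset.mem_image.2 ⟨ω, by simpa using h, rfl⟩, (hmin ω ω x).2 fun _ _ => rfl⟩

end CausalModel

/-- A probabilistic Boolean causal model: a causal model with a distribution on situations. -/
structure ProbCausalModel (U : Type u) (V : Type v) : Type (max u v) extends CausalModel U V where
  dist : PMF (U → Bool)

namespace ProbCausalModel

variable {U : Type u} {V : Type v} (M : ProbCausalModel U V)

open Classical in
/-- The distribution of the model on worlds: `ω` has the probability of its situation `u` if it
is the solution determined by `u` (unique if the model is acyclic), and `0` otherwise. -/
noncomputable def worldProb (ω : World (U ⊕ V)) : ℝ :=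
  if M.IsSolution ω then (M.dist fun e => ω (Sum.inl e)).toReal else 0

variable [Fintype U] [Fintype V]

open Classical in
/-- The probability of an event under the distribution of the model. -/
noncomputable def prob (A : Set (World (U ⊕ V))) : ℝ := ∑ ω with ω ∈ A, M.worldProb ω

/-- The conjunction of the literals of a situation. -/
noncomputable def situationFormula (V : Type v) (s : U → Bool) : Formula (U ⊕ V) :=
  Formula.conj ((Finset.univ : Finset U).toList.map fun e =>
    (⟨Sum.inl e, s e⟩ : Literal (U ⊕ V)).toFormula)

open Classical in
/-- The Bochman transformation. The logarithm takes the value `-∞` at `0`. -/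
noncomputable def bochman (R : M.Presentation) : CausalSystem (U ⊕ V) where
  knowledge := Finset.univ.biUnion fun x : V =>
    (R.causes x).image fun φ => (⊤, ⟨φ, ⟨Sum.inr x, true⟩⟩)
  premises := {l | (∃ e : U, l = ⟨Sum.inl e, true⟩) ∨ ∃ p : U ⊕ V, l = ⟨p, false⟩}
  observations := ∅
  science := Finset.univ.image fun s : U → Bool =>
    (ENNReal.log (M.dist s), situationFormula V s)

end ProbCausalModel

end MaxEnt

namespace MaxEnt

universe u v

/-! ### Propositional logic and causal production inference -/

section Logic

variable {P : Type u}

namespace Formula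

/-! Acyclicity of the model makes every strongly connected component of the causal structure a
singleton, and the pure external premises are exactly `U`. The network therefore has one node for
the situation and one node for each internal variable `x`.

At the node `x`, the hard rules `φ ⇒ x` give the implication from `F x` to `x` in every world of
nonzero weight (`bochman_rulesFor_weight`). Causal sufficiency gives the converse
(`mem_bochman_sufficient`): the only external premise over `x` is `¬ x`, so a false `x` explains
itself, whereas a true `x` has to be produced by a rule with a true cause. That nothing else
produces `x` follows from soundness (`Produces.sat`), applied in the world with `x` flipped to
false. Together the two implications are the structural equation of `x`, and the demonstration
probability is its indicator (`bochman_demoProb`). The conditioning event is not null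
(`bochman_demo_condition_pos`), because `x` is not its own parent and can be set to the value of `F
x`.

The science gives a world the weight of its situation, whatever the internal values are, so
normalization cancels the number of internal assignments (`bochman_science_prob`). The network thus
multiplies the probability of the situation by the indicators of all structural equations, which is
the distribution of the model (`bochman_worldProb`). Its total mass is one by existence and
uniqueness of solutions (`prob_univ`). As there are no observations, neither conditioning nor
restricting the observations changes anything. -/

theorem sat_congr {ω ω' : World P} {φ : Formula P} (h : ∀ p ∈ φ.atoms, ω p = ω' p) :
    φ.Sat ω ↔ φ.Sat ω' := by
  induction φ with
  | atom p => simp only [Sat, h p rfl]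
  | top => rfl
  | bot => rfl
  | neg φ ih => exact not_congr (ih h)
  | and φ ψ ih₁ ih₂ =>
    exact and_congr (ih₁ fun p hp => h p (Or.inl hp)) (ih₂ fun p hp => h p (Or.inr hp))
  | or φ ψ ih₁ ih₂ =>
    exact or_congr (ih₁ fun p hp => h p (Or.inl hp)) (ih₂ fun p hp => h p (Or.inr hp))
  | imp φ ψ ih₁ ih₂ =>
    exact imp_congr (ih₁ fun p hp => h p (Or.inl hp)) (ih₂ fun p hp => h p (Or.inr hp))

theorem sat_conj {ω : World P} {l : List (Formula P)} :
    (conj l).Sat ω ↔ ∀ φ ∈ l, φ.Sat ω := by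
  induction l with
  | nil => simp [conj, Sat]
  | cons φ l ih => simp [conj, Sat, ih]

end Formula

theorem Literal.sat_toFormula {ω : World P} {l : Literal P} :
    l.toFormula.Sat ω ↔ l.Holds ω := by
  obtain ⟨p, s⟩ := l
  cases s <;> simp [Literal.toFormula, Formula.Sat, Literal.Holds]

/-- Soundness: read as material implications, all closure properties preserve truth in one fixed
world. This is the tool for showing that a formula is not a consequence. -/
theorem Produces.sat {Δ : Set (Rule P)} {ω : World P} (hΔ : ∀ R ∈ Δ, R.constraint.Sat ω)
    {φ ψ : Formula P} (h : Produces Δ φ ψ) : φ.Sat ω → ψ.Sat ω := by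
  induction h with
  | rule R hR => exact hΔ R hR
  | strengthening φ ψ ρ h _ ih => exact fun hφ => ih (h ω hφ)
  | weakening φ ψ ρ _ h ih => exact fun hφ => h ω (ih hφ)
  | and φ ψ ρ _ _ ih₁ ih₂ => exact fun hφ => ⟨ih₁ hφ, ih₂ hφ⟩
  | truth => exact id
  | falsity => exact id
  | cut φ ψ ρ _ _ ih₁ ih₂ => exact fun hφ => ih₂ ⟨hφ, ih₁ hφ⟩
  | or φ ψ ρ _ _ ih₁ ih₂ => exact fun h => h.elim ih₁ ih₂

theorem sat_of_mem_consequences {Δ : Set (Rule P)} {Φ : Set (Formula P)} {ω : World P}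
    (hΔ : ∀ R ∈ Δ, R.constraint.Sat ω) (hΦ : ∀ φ ∈ Φ, φ.Sat ω) {ψ : Formula P}
    (h : ψ ∈ consequences Δ Φ) : ψ.Sat ω := by
  obtain ⟨l, hl, hp⟩ := h
  exact hp.sat hΔ (Formula.sat_conj.2 fun φ hφ => hΦ φ (hl φ hφ))

/-- A single rule between a strengthening and a weakening; every derivation needed below has this
shape. -/
theorem mem_consequences_of_rule {Δ : Set (Rule P)} {Φ : Set (Formula P)} {R : Rule P}
    (hR : R ∈ Δ) {l : List (Formula P)} (hl : ∀ φ ∈ l, φ ∈ Φ)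
    (h : (Formula.conj l).Entails R.cause) {ψ : Formula P} (hψ : R.effect.Entails ψ) :
    ψ ∈ consequences Δ Φ :=
  ⟨l, hl, .weakening _ _ _ (.strengthening _ _ _ h (.rule R hR)) hψ⟩

namespace DetSystem

variable {CS : DetSystem P} {ω : World P}

theorem sat_of_mem_premisesIn {ω' : World P}
    (h : ∀ l ∈ CS.premises, l.Holds ω → l.Holds ω') {φ : Formula P}
    (hφ : φ ∈ CS.premisesIn ω) : φ.Sat ω' := by
  obtain ⟨l, ⟨hl, hlω⟩, rfl⟩ := hφ
  exact Literal.sat_toFormula.2 (h l hl hlω)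

/-- The rule `l ⇒ l` settles the proposition of `l`: according to the sign of `m`, the premise `l`
entails `m` or its negation. -/
theorem explains_of_mem_premises {l m : Literal P} (hl : l ∈ CS.premises) (hω : l.Holds ω)
    (hm : m.prop = l.prop) : CS.Explains ω m.toFormula := by
  have key : ∀ ψ : Formula P, l.toFormula.Entails ψ →
      ψ ∈ consequences (CS.content ω).closure (CS.premisesIn ω) := by
    intro ψ hψ
    refine mem_consequences_of_rule (R := ⟨l.toFormula, l.toFormula⟩) (l := [l.toFormula])
      (Or.inr ⟨l, hl, rfl⟩) ?_ ?_ hψ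
    · intro φ hφ
      rw [List.mem_singleton] at hφ
      exact ⟨l, ⟨hl, hω⟩, hφ.symm⟩
    · intro ω' h
      exact Formula.sat_conj.1 h _ (List.mem_singleton.2 rfl)
  by_cases hs : m.sign = l.sign
  · left
    apply key
    intro ω' h
    rw [Literal.sat_toFormula] at h ⊢
    rw [Literal.Holds, hm, hs]
    exact h
  · right
    apply key
    intro ω' h
    change ¬ m.toFormula.Sat ω'
    rw [Literal.sat_toFormula] at h ⊢
    rw [Literal.Holds, hm]
    exact fun h' => hs (h'.symm.trans h)

end DetSystem

end Logic

/-! ### LogLinear models -/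

namespace LogLinear

variable {P : Type u} [Fintype P] {Φ : LogLinear P} {A B : Set (World P)}

theorem eventWeight_pos {ω : World P} (hω : ω ∈ A) (h : 0 < Φ.weight ω) :
    0 < Φ.eventWeight A := by
  classical
  refine Finset.sum_pos' (fun _ _ => Φ.weight_nonneg _) ⟨ω, ?_, h⟩
  simpa using hω

theorem prob_pos {ω : World P} (hω : ω ∈ A) (h : 0 < Φ.weight ω) : 0 < Φ.prob A :=
  div_pos (eventWeight_pos hω h) (eventWeight_pos (Set.mem_univ ω) h)

theorem prob_congr (h : ∀ ω, Φ.weight ω ≠ 0 → (ω ∈ A ↔ ω ∈ B)) : Φ.prob A = Φ.prob B := by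
  classical
  unfold prob eventWeight
  congr 1
  rw [Finset.sum_filter, Finset.sum_filter]
  refine Finset.sum_congr rfl fun ω _ => ?_
  by_cases hω : Φ.weight ω = 0
  · simp [hω]
  · simp [h ω hω]

theorem prob_empty : Φ.prob (∅ : Set (World P)) = 0 := by
  simp [prob, eventWeight]

open Classical in
-- Each world lies in exactly one of the events `assign V v`. A null condition has to be excluded,
-- since its conditional probabilities are all `0`.
theorem sum_condProb_assign (V : Set P) (hB : Φ.prob B ≠ 0) :
    ∑ v : V → Bool, Φ.condProb (assign V v) B = 1 := by
  unfold condProb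
  rw [← Finset.sum_div, div_eq_one_iff_eq hB]
  unfold prob eventWeight
  rw [← Finset.sum_div]
  congr 1
  simp only [Finset.sum_filter]
  rw [Finset.sum_comm]
  refine Finset.sum_congr rfl fun ω _ => ?_
  rw [Finset.sum_eq_single (fun p : V => ω p)]
  · simp [assign]
  · intro v _ hv
    rw [if_neg]
    exact fun h => hv (funext fun p => (h.1 p).symm)
  · simp

/-- If all constraints are hard, then every possible world has weight one. -/
theorem weight_of_hard {P : Type u} {Φ : LogLinear P} (h : ∀ c ∈ Φ, c.1 = ⊤) (ω : World P)
    [Decidable (∀ c ∈ Φ, c.2.Sat ω)] :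
    Φ.weight ω = if ∀ c ∈ Φ, c.2.Sat ω then 1 else 0 := by
  classical
  unfold weight
  have hP : Φ.Possible ω ↔ ∀ c ∈ Φ, c.2.Sat ω := by
    refine forall₂_congr fun c hc => ?_
    simp [h c hc]
  simp only [hP]
  split_ifs
  · rw [Finset.filter_false_of_mem, Finset.prod_empty]
    intro c hc h'
    exact h'.1 (h c hc)
  · rfl

end LogLinear

/-! ### Solutions of acyclic causal models -/

namespace CausalModel

variable {U : Type u} {V : Type v} {M : CausalModel U V}

theorem Acyclic.wellFounded [Finite V] (hM : M.Acyclic) :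
    WellFounded fun y z => y ∈ M.pa z := by
  have : Std.Irrefl (Relation.TransGen fun y z => y ∈ M.pa z) := ⟨hM⟩
  have : IsTrans V (Relation.TransGen fun y z => y ∈ M.pa z) := ⟨fun _ _ _ => .trans⟩
  refine Subrelation.wf (r := Relation.TransGen fun y z => y ∈ M.pa z)
    (fun h => Relation.TransGen.single h) ?_
  exact Finite.wellFounded_of_trans_of_irrefl _

theorem Acyclic.exists_solution [Finite V] (hM : M.Acyclic) (s : U → Bool) :
    ∃ ω, M.IsSolution ω ∧ (fun e => ω (Sum.inl e)) = s := by
  let f : V → Bool := hM.wellFounded.fix fun x ih => M.F x (fun y => ih y y.2) fun e => s e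
  refine ⟨Sum.elim s f, fun x => ?_, rfl⟩
  exact hM.wellFounded.fix_eq _ x

theorem Acyclic.solution_unique [Finite V] (hM : M.Acyclic) {ω ω' : World (U ⊕ V)}
    (h : M.IsSolution ω) (h' : M.IsSolution ω')
    (he : (fun e => ω (Sum.inl e)) = fun e => ω' (Sum.inl e)) : ω = ω' := by
  have key : ∀ x, ω (Sum.inr x) = ω' (Sum.inr x) := by
    intro x
    induction x using hM.wellFounded.induction with
    | _ x ih =>
      rw [h x, h' x]
      congr 1
      · exact funext fun y => ih y y.2
      · exact funext fun e => congrFun he e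
  funext p
  rcases p with e | x
  · exact congrFun he e
  · exact key x

end CausalModel

namespace ProbCausalModel

variable {U : Type u} {V : Type v} {M : ProbCausalModel U V} [Fintype U]

open Classical in
theorem sum_dist_toReal : ∑ s : U → Bool, (M.dist s).toReal = 1 := by
  rw [← ENNReal.toReal_sum fun s _ => M.dist.apply_ne_top s, ← tsum_fintype (L := .unconditional _),
    M.dist.tsum_coe, ENNReal.toReal_one]

/-- Restriction to `U` is a bijection from solutions to situations. -/
theorem prob_univ [Fintype V] (hM : M.Acyclic) : M.prob Set.univ = 1 := by
  classical
  rw [← sum_dist_toReal (M := M)]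
  simp only [prob, Set.mem_univ, Finset.filter_true, worldProb]
  rw [← Finset.sum_filter]
  refine Finset.sum_nbij (fun ω e => ω (Sum.inl e)) (by simp) ?_ ?_ (by simp)
  · intro ω h ω' h' he
    simp only [Finset.coe_filter, Finset.mem_univ, true_and, Set.mem_ofPred_eq] at h h'
    exact hM.solution_unique h h' he
  · intro s _
    obtain ⟨ω, h, hs⟩ := hM.exists_solution s
    exact ⟨ω, by simpa using h, hs⟩

/-! ### The superordinate science of the Bochman transformation -/

theorem sat_situationFormula {s : U → Bool} {ω : World (U ⊕ V)} :
    (situationFormula V s).Sat ω ↔ (fun e => ω (Sum.inl e)) = s := by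
  rw [situationFormula, Formula.sat_conj]
  simp [Literal.sat_toFormula, Literal.Holds, funext_iff]

variable [Fintype V]

/-- Exactly one situation formula holds in `ω`. If its situation is null, its weight `-∞` makes it a
violated hard constraint; otherwise it contributes the only factor. -/
theorem bochman_science_weight (R : M.Presentation) (ω : World (U ⊕ V)) :
    (M.bochman R).science.weight ω = (M.dist fun e => ω (Sum.inl e)).toReal := by
  classical
  set s : U → Bool := fun e => ω (Sum.inl e) with hs
  have hmem : ∀ c, c ∈ (M.bochman R).science ↔
      ∃ t : U → Bool, (ENNReal.log (M.dist t), situationFormula V t) = c := by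
    intro c
    simp [bochman]
  have hP : (M.bochman R).science.Possible ω ↔ M.dist s ≠ 0 := by
    constructor
    · intro h h0
      exact (h _ ((hmem _).2 ⟨s, rfl⟩)).2 (by simp [h0]) (sat_situationFormula.2 rfl)
    · rintro h c hc
      obtain ⟨t, rfl⟩ := (hmem c).1 hc
      refine ⟨fun h' => absurd (ENNReal.log_eq_top_iff.1 h') (M.dist.apply_ne_top t), fun h' hsat => ?_⟩
      rw [sat_situationFormula] at hsat
      rw [← hs] at hsat
      subst hsat
      exact h (ENNReal.log_eq_bot_iff.1 h')
  unfold LogLinear.weight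
  rw [hP]
  split_ifs with h
  · rw [Finset.prod_eq_single (ENNReal.log (M.dist s), situationFormula V s)]
    · have hpos : 0 < (M.dist s).toReal := ENNReal.toReal_pos h (M.dist.apply_ne_top s)
      rw [ENNReal.log_pos_real h (M.dist.apply_ne_top s), EReal.toReal_coe, Real.exp_log hpos]
    · rintro c hc hne
      obtain ⟨hc, -, -, hsat⟩ := Finset.mem_filter.1 hc
      obtain ⟨t, rfl⟩ := (hmem c).1 hc
      rw [sat_situationFormula] at hsat
      exact absurd (by rw [← hsat]) hne
    · intro hn
      refine absurd (Finset.mem_filter.2 ⟨(hmem _).2 ⟨s, rfl⟩, ?_, ?_, ?_⟩) hn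
      · exact fun h' => M.dist.apply_ne_top s (ENNReal.log_eq_top_iff.1 h')
      · exact fun h' => h (ENNReal.log_eq_bot_iff.1 h')
      · exact sat_situationFormula.2 rfl
  · rw [not_not] at h
    simp [h]

omit [Fintype U] [Fintype V] in
-- Each situation is counted once per internal assignment; this constant cancels in the
-- normalization of the science.
theorem sum_world_eq [Fintype (World (U ⊕ V))] [Fintype (U → Bool)] [Fintype (V → Bool)]
    (f : (U → Bool) → ℝ) : ∑ ω : World (U ⊕ V), f (fun e => ω (Sum.inl e)) =
      Fintype.card (V → Bool) * ∑ s : U → Bool, f s := by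
  refine (Fintype.sum_equiv (Equiv.sumArrowEquivProdArrow U V Bool) _ (fun q => f q.1)
    fun _ => rfl).trans ?_
  rw [Fintype.sum_prod_type]
  simp [Finset.mul_sum]

theorem bochman_science_prob (R : M.Presentation) (s : U → Bool) :
    (M.bochman R).science.prob {ω | (fun e => ω (Sum.inl e)) = s} = (M.dist s).toReal := by
  classical
  simp only [LogLinear.prob, LogLinear.eventWeight, bochman_science_weight, Finset.sum_filter,
    Set.mem_univ, if_true, Set.mem_ofPred_eq]
  have hcard : (Fintype.card (V → Bool) : ℝ) ≠ 0 := by exact_mod_cast Fintype.card_ne_zero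
  have hnum := sum_world_eq (V := V) fun t => if t = s then (M.dist t).toReal else 0
  have hden := sum_world_eq (V := V) fun t => (M.dist t).toReal
  rw [Finset.sum_ite_eq', if_pos (Finset.mem_univ s)] at hnum
  rw [sum_dist_toReal, mul_one] at hden
  rw [← mul_div_cancel_left₀ (M.dist s).toReal hcard, ← hnum, ← hden]
  congr!

/-! ### The causal structure of the Bochman transformation -/

section Structure

variable (R : M.Presentation)

theorem mem_bochman_knowledge {r : EReal × LiteralRule (U ⊕ V)} :
    r ∈ (M.bochman R).knowledge ↔
      ∃ x, ∃ φ ∈ R.causes x, r = (⊤, ⟨φ, ⟨Sum.inr x, true⟩⟩) := by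
  classical
  simp [bochman, eq_comm]

theorem mem_bochman_explanatory {S : LiteralRule (U ⊕ V)} :
    S ∈ (M.bochman R).knowledge.explanatory ↔
      ∃ x, ∃ φ ∈ R.causes x, S = ⟨φ, ⟨Sum.inr x, true⟩⟩ := by
  simp [WeightedTheory.explanatory, mem_bochman_knowledge]

theorem bochman_pure : (M.bochman R).pure = Set.range Sum.inl := by
  ext p
  rcases p with e | x <;> simp [CausalSystem.pure, bochman]

theorem bochman_propEdge {p q : U ⊕ V} :
    (M.bochman R).propEdge p q ↔
      ∃ x, q = Sum.inr x ∧ ∃ φ ∈ R.causes x, p ∈ φ.atoms := by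
  simp only [CausalSystem.propEdge, mem_bochman_explanatory]
  constructor
  · rintro ⟨S, ⟨x, φ, hφ, rfl⟩, hp, rfl⟩
    exact ⟨x, rfl, φ, hφ, hp⟩
  · rintro ⟨x, rfl, φ, hφ, hp⟩
    exact ⟨_, ⟨x, φ, hφ, rfl⟩, hp, rfl⟩

variable {R}

theorem mem_pa_of_propEdge {x y : V}
    (h : (M.bochman R).propEdge (Sum.inr y) (Sum.inr x)) : y ∈ M.pa x := by
  obtain ⟨x', hx, φ, hφ, hp⟩ := (bochman_propEdge R).1 h
  obtain rfl := Sum.inr.inj hx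
  rcases R.atoms_subset _ φ hφ hp with ⟨e, -, h⟩ | ⟨z, hz, h⟩
  · cases h
  · obtain rfl := Sum.inr.inj h
    exact hz

/-- No edge ends in an external variable, so a path that starts at an internal variable stays
internal and is a path of the causal diagram. -/
theorem transGen_pa_of_transGen_propEdge {x : V} {p : U ⊕ V}
    (h : Relation.TransGen (M.bochman R).propEdge (Sum.inr x) p) :
    ∃ y, p = Sum.inr y ∧ Relation.TransGen (fun y z => y ∈ M.pa z) x y := by
  induction h with
  | single e =>
    obtain ⟨y, rfl, -⟩ := (bochman_propEdge R).1 e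
    exact ⟨y, rfl, .single (mem_pa_of_propEdge e)⟩
  | tail _ e ih =>
    obtain ⟨y, rfl, ih⟩ := ih
    obtain ⟨z, rfl, -⟩ := (bochman_propEdge R).1 e
    exact ⟨z, rfl, ih.tail (mem_pa_of_propEdge e)⟩

theorem bochman_not_transGen (hM : M.Acyclic) (p : U ⊕ V) :
    ¬ Relation.TransGen (M.bochman R).propEdge p p := by
  intro h
  rcases p with e | x
  · obtain ⟨q, -, h⟩ := Relation.TransGen.tail'_iff.1 h
    obtain ⟨x, hx, -⟩ := (bochman_propEdge R).1 h
    cases hx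
  · obtain ⟨y, hy, h⟩ := transGen_pa_of_transGen_propEdge h
    obtain rfl := Sum.inr.inj hy
    exact hM _ h

theorem bochman_component (hM : M.Acyclic) (p : U ⊕ V) : (M.bochman R).component p = {p} := by
  ext q
  constructor
  · rintro ⟨h₁, h₂⟩
    rcases Relation.reflTransGen_iff_eq_or_transGen.1 h₁ with h | h
    · exact h
    · exact absurd (h.trans_left h₂) (bochman_not_transGen hM p)
  · rintro rfl
    exact ⟨.refl, .refl⟩

theorem bochman_components (hM : M.Acyclic) {A : Set (U ⊕ V)} :
    A ∈ (M.bochman R).components ↔ ∃ p, A = {p} := by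
  simp [CausalSystem.components, bochman_component hM, eq_comm]

/-- Blocks are singletons, and acyclicity makes the no-loop condition on block edges automatic. The
parents depend on the presentation and may be fewer than the arguments of `F x`. -/
theorem mem_bochman_parents (hM : M.Acyclic) {x : V} {p : U ⊕ V} :
    p ∈ (M.bochman R).parents {Sum.inr x} ↔ ∃ φ ∈ R.causes x, p ∈ φ.atoms := by
  have hedge : (M.bochman R).propEdge p (Sum.inr x) ↔ ∃ φ ∈ R.causes x, p ∈ φ.atoms := by
    rw [bochman_propEdge]
    constructor
    · rintro ⟨y, hy, h⟩
      obtain rfl := Sum.inr.inj hy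
      exact h
    · exact fun h => ⟨x, rfl, h⟩
  rw [← hedge]
  constructor
  · rintro ⟨W, hW, ⟨-, a, ha, b, rfl, e⟩, hp⟩
    obtain ⟨q, rfl⟩ := (bochman_components hM).1 hW
    rw [Set.mem_singleton_iff] at ha hp
    rwa [hp, ← ha]
  · intro e
    refine ⟨{p}, (bochman_components hM).2 ⟨p, rfl⟩, ⟨?_, p, rfl, _, rfl, e⟩, rfl⟩
    intro h
    rw [Set.singleton_eq_singleton_iff] at h
    subst h
    exact bochman_not_transGen hM _ (.single e)

theorem inr_notMem_bochman_parents (hM : M.Acyclic) (x : V) :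
    Sum.inr x ∉ (M.bochman R).parents {Sum.inr x} := by
  intro h
  exact bochman_not_transGen hM _
    (.single ((bochman_propEdge R).2 ⟨x, rfl, (mem_bochman_parents hM).1 h⟩))

/-- An argument of `F x` that occurs in none of the representing formulas cannot influence its
value. -/
theorem F_congr (hM : M.Acyclic) {x : V} {ω ω' : World (U ⊕ V)}
    (h : ∀ p ∈ (M.bochman R).parents {Sum.inr x}, ω p = ω' p) :
    M.F x (fun y => ω (Sum.inr y)) (fun e => ω (Sum.inl e)) =
      M.F x (fun y => ω' (Sum.inr y)) (fun e => ω' (Sum.inl e)) := by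
  rw [Bool.eq_iff_iff, ← R.represents, ← R.represents]
  refine exists_congr fun φ => and_congr_right fun hφ => Formula.sat_congr fun p hp => h p ?_
  exact (mem_bochman_parents hM).2 ⟨φ, hφ, hp⟩

/-! ### Demonstrations in the Bochman transformation -/

theorem mem_bochman_rulesFor {x : V} {r : EReal × LiteralRule (U ⊕ V)} :
    r ∈ (M.bochman R).rulesFor {Sum.inr x} ↔
      ∃ φ ∈ R.causes x, r = (⊤, ⟨φ, ⟨Sum.inr x, true⟩⟩) := by
  classical
  simp only [CausalSystem.rulesFor, Finset.mem_filter, mem_bochman_knowledge,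
    Set.mem_singleton_iff]
  constructor
  · rintro ⟨⟨y, φ, hφ, rfl⟩, hy⟩
    obtain rfl := Sum.inr.inj hy
    exact ⟨φ, hφ, rfl⟩
  · rintro ⟨φ, hφ, rfl⟩
    exact ⟨⟨x, φ, hφ, rfl⟩, rfl⟩

theorem mem_bochman_localSystem_knowledge {x : V} {S : LiteralRule (U ⊕ V)} :
    S ∈ ((M.bochman R).localSystem {Sum.inr x}).knowledge ↔
      ∃ φ ∈ R.causes x, S = ⟨φ, ⟨Sum.inr x, true⟩⟩ := by
  simp [CausalSystem.localSystem, WeightedTheory.explanatory, mem_bochman_rulesFor]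

theorem mem_bochman_localSystem_premises {x : V} {l : Literal (U ⊕ V)} :
    l ∈ ((M.bochman R).localSystem {Sum.inr x}).premises ↔
      l.prop ∈ (M.bochman R).parents {Sum.inr x} ∨ l = ⟨Sum.inr x, false⟩ := by
  obtain ⟨p, s⟩ := l
  simp only [CausalSystem.localSystem, bochman, Set.mem_union, Set.mem_ofPred_eq,
    Set.mem_singleton_iff, Literal.mk.injEq]
  refine or_congr Iff.rfl ?_
  constructor
  · rintro ⟨⟨e, rfl, -⟩ | ⟨q, rfl, rfl⟩, h⟩
    · cases h
    · exact ⟨h, rfl⟩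
  · rintro ⟨rfl, rfl⟩
    exact ⟨Or.inr ⟨_, rfl, rfl⟩, rfl⟩

open Classical in
theorem bochman_rulesFor_weight (x : V) (ω : World (U ⊕ V)) :
    ((M.bochman R).rulesFor {Sum.inr x}).constraint.weight ω =
      if (∃ φ ∈ R.causes x, φ.Sat ω) → ω (Sum.inr x) = true then 1 else 0 := by
  have hmem : ∀ c, c ∈ ((M.bochman R).rulesFor {Sum.inr x}).constraint ↔
      ∃ φ ∈ R.causes x, c = (⊤, Formula.imp φ (.atom (Sum.inr x))) := by
    intro c
    simp only [WeightedTheory.constraint, Finset.mem_image, mem_bochman_rulesFor]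
    constructor
    · rintro ⟨r, ⟨φ, hφ, rfl⟩, rfl⟩
      exact ⟨φ, hφ, rfl⟩
    · rintro ⟨φ, hφ, rfl⟩
      exact ⟨_, ⟨φ, hφ, rfl⟩, rfl⟩
  rw [LogLinear.weight_of_hard]
  · refine if_congr ?_ rfl rfl
    constructor
    · rintro h ⟨φ, hφ, hs⟩
      exact h _ ((hmem _).2 ⟨φ, hφ, rfl⟩) hs
    · rintro h c hc
      obtain ⟨φ, hφ, rfl⟩ := (hmem c).1 hc
      exact fun hs => h ⟨φ, hφ, hs⟩
  · intro c hc
    obtain ⟨φ, -, rfl⟩ := (hmem c).1 hc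
    rfl

/-- The parents are explained by premises and a false `x` by the default `¬ x`. The content lies in
a true `x`: it needs a rule whose cause holds. -/
theorem mem_bochman_sufficient (hM : M.Acyclic) {x : V} {ω : World (U ⊕ V)} :
    ω ∈ ((M.bochman R).localSystem {Sum.inr x}).sufficient
        ({Sum.inr x} ∪ (M.bochman R).parents {Sum.inr x}) ↔
      (ω (Sum.inr x) = true → ∃ φ ∈ R.causes x, φ.Sat ω) := by
  classical
  set CS := (M.bochman R).localSystem {Sum.inr x} with hCS
  constructor
  · intro h hx
    by_contra hno
    -- Since `x` is true in `ω`, the default `¬ x` is not available there.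
    have hprem : ∀ l ∈ CS.premises, l.Holds ω → l.prop ∈ (M.bochman R).parents {Sum.inr x} := by
      intro l hl hω
      rcases mem_bochman_localSystem_premises.1 hl with hl | rfl
      · exact hl
      · exact absurd (hx.symm.trans hω) (by simp)
    rcases h ⟨Sum.inr x, true⟩ (Or.inl rfl) with h | h
    -- Countermodel to the production of `x`: flipping `x` leaves the parents unchanged, so the
    -- premises stay true, and the causes of `x` stay false, which makes the rules vacuously true.
    · set ω' : World (U ⊕ V) := Function.update ω (Sum.inr x) false with hω'
      have heq : ∀ p ∈ (M.bochman R).parents {Sum.inr x}, ω' p = ω p := by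
        intro p hp
        refine Function.update_of_ne ?_ _ _
        rintro rfl
        exact inr_notMem_bochman_parents hM x hp
      have hsat := sat_of_mem_consequences (ω := ω') ?_ ?_ h
      · rw [Literal.sat_toFormula] at hsat
        simp [Literal.Holds, hω'] at hsat
      · rintro S (⟨T, ⟨hT, -⟩, rfl⟩ | ⟨l, -, rfl⟩)
        · obtain ⟨φ, hφ, rfl⟩ := mem_bochman_localSystem_knowledge.1 hT
          intro hs
          refine absurd ⟨φ, hφ, (Formula.sat_congr fun p hp => ?_).1 hs⟩ hno
          exact heq p ((mem_bochman_parents hM).2 ⟨φ, hφ, hp⟩)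
        · exact id
      · intro φ hφ
        refine DetSystem.sat_of_mem_premisesIn (fun l hl hω => ?_) hφ
        exact (heq _ (hprem l hl hω)).trans hω
    -- Here `¬ x` would be produced; soundness in `ω` itself contradicts the truth of `x`.
    · have hsat := sat_of_mem_consequences (ω := ω) ?_ ?_ h
      · exact hsat hx
      · rintro S (⟨T, ⟨-, hT⟩, rfl⟩ | ⟨l, -, rfl⟩)
        · exact hT
        · exact id
      · exact fun φ hφ => DetSystem.sat_of_mem_premisesIn (fun l _ hω => hω) hφ
  · rintro h l (hl | hl)
    · rcases hx : ω (Sum.inr x) with _ | _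
      · exact DetSystem.explains_of_mem_premises (l := ⟨Sum.inr x, false⟩)
          (mem_bochman_localSystem_premises.2 (Or.inr rfl)) hx hl
      · obtain ⟨φ, hφ, hs⟩ := h hx
        have key : ∀ ψ : Formula (U ⊕ V), (Formula.atom (Sum.inr x)).Entails ψ →
            ψ ∈ consequences (CS.content ω).closure (CS.premisesIn ω) := by
          intro ψ hψ
          -- The literals of `ω` over the parents fix all atoms of `φ`, hence their conjunction
          -- entails `φ`. The rule survives in the content of `ω` because its effect is true there.
          refine mem_consequences_of_rule (R := ⟨φ, .atom (Sum.inr x)⟩)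
            (l := (Finset.univ.filter fun p => p ∈ (M.bochman R).parents {Sum.inr x}).toList.map
              fun p => (⟨p, ω p⟩ : Literal (U ⊕ V)).toFormula) ?_ ?_ ?_ hψ
          · exact Or.inl ⟨⟨φ, ⟨Sum.inr x, true⟩⟩,
              ⟨mem_bochman_localSystem_knowledge.2 ⟨φ, hφ, rfl⟩, fun _ => hx⟩, rfl⟩
          · intro χ hχ
            obtain ⟨p, hp, rfl⟩ := List.mem_map.1 hχ
            exact ⟨⟨p, ω p⟩,
              ⟨mem_bochman_localSystem_premises.2 (Or.inl (by simpa using hp)), rfl⟩, rfl⟩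
          · intro ω' hω'
            rw [Formula.sat_conj] at hω'
            refine (Formula.sat_congr fun p hp => ?_).1 hs
            have := hω' _ (List.mem_map.2 ⟨p, by
              simpa using (mem_bochman_parents hM).2 ⟨φ, hφ, hp⟩, rfl⟩)
            exact (Literal.sat_toFormula.1 this).symm
        obtain ⟨p, s⟩ := l
        obtain rfl : p = Sum.inr x := hl
        cases s
        · exact Or.inr (key _ fun ω' h h' => h' h)
        · exact Or.inl (key _ fun ω' h => h)
    · exact DetSystem.explains_of_mem_premises (l := ⟨l.prop, ω l.prop⟩)
        (mem_bochman_localSystem_premises.2 (Or.inl hl)) rfl rfl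

omit [Fintype U] [Fintype V] in
theorem eq_F_iff {x : V} {ω : World (U ⊕ V)} :
    ω (Sum.inr x) = M.F x (fun y => ω (Sum.inr y)) (fun e => ω (Sum.inl e)) ↔
      (ω (Sum.inr x) = true ↔ ∃ φ ∈ R.causes x, φ.Sat ω) := by
  rw [Bool.eq_iff_iff, R.represents]

/-- Among the worlds that are possible and sufficient for `x`, those that solve the structural
equation of `x` remain. -/
theorem eq_F_of_mem_sufficient (hM : M.Acyclic) {x : V} {ω : World (U ⊕ V)}
    (hs : ω ∈ ((M.bochman R).localSystem {Sum.inr x}).sufficient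
        ({Sum.inr x} ∪ (M.bochman R).parents {Sum.inr x}))
    (hw : ((M.bochman R).rulesFor {Sum.inr x}).constraint.weight ω ≠ 0) :
    ω (Sum.inr x) = M.F x (fun y => ω (Sum.inr y)) (fun e => ω (Sum.inl e)) := by
  classical
  rw [bochman_rulesFor_weight] at hw
  exact (eq_F_iff (R := R)).2 ⟨(mem_bochman_sufficient hM).1 hs, by simpa using hw⟩

theorem bochman_demo_condition_pos (hM : M.Acyclic) (x : V)
    (pa : (M.bochman R).parents {Sum.inr x} → Bool) :
    0 < ((M.bochman R).rulesFor {Sum.inr x}).constraint.prob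
      (assign ((M.bochman R).parents {Sum.inr x}) pa ∩
        ((M.bochman R).localSystem {Sum.inr x}).sufficient
          ({Sum.inr x} ∪ (M.bochman R).parents {Sum.inr x})) := by
  classical
  -- The value `false` off the parents is arbitrary. Setting `x` to the value of `F x` afterwards
  -- changes neither the parents nor that value.
  let ω₀ : World (U ⊕ V) := fun p =>
    if hp : p ∈ (M.bochman R).parents {Sum.inr x} then pa ⟨p, hp⟩ else false
  let ω : World (U ⊕ V) := Function.update ω₀ (Sum.inr x)
    (M.F x (fun y => ω₀ (Sum.inr y)) fun e => ω₀ (Sum.inl e))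
  have heq : ∀ p ∈ (M.bochman R).parents {Sum.inr x}, ω p = ω₀ p := by
    intro p hp
    refine Function.update_of_ne ?_ _ _
    rintro rfl
    exact inr_notMem_bochman_parents hM x hp
  have hF : ω (Sum.inr x) = M.F x (fun y => ω (Sum.inr y)) (fun e => ω (Sum.inl e)) := by
    rw [F_congr hM heq]
    exact Function.update_self _ _ _
  rw [eq_F_iff (R := R)] at hF
  refine LogLinear.prob_pos (ω := ω) ⟨fun p => ?_, (mem_bochman_sufficient hM).2 hF.1⟩ ?_
  · rw [heq p p.2]
    exact dif_pos p.2
  · rw [bochman_rulesFor_weight, if_pos hF.2]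
    exact one_pos

open Classical in
-- Given the parents, every sufficient world of nonzero weight has the same value of `x`, the one
-- dictated by `F x`. So the event for `x` has conditional probability one or zero.
theorem bochman_demoProb (hM : M.Acyclic) (x : V) (ω : World (U ⊕ V)) :
    (M.bochman R).demoProb {Sum.inr x} (fun p => ω p) (fun p => ω p) =
      if ω (Sum.inr x) = M.F x (fun y => ω (Sum.inr y)) (fun e => ω (Sum.inl e))
        then 1 else 0 := by
  have hpos := bochman_demo_condition_pos (R := R) hM x fun p => ω p
  have hF : ∀ ω', ω' ∈ assign ((M.bochman R).parents {Sum.inr x}) (fun p => ω p) →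
      M.F x (fun y => ω' (Sum.inr y)) (fun e => ω' (Sum.inl e)) =
        M.F x (fun y => ω (Sum.inr y)) (fun e => ω (Sum.inl e)) :=
    fun ω' h => F_congr hM fun p hp => h ⟨p, hp⟩
  unfold CausalSystem.demoProb LogLinear.condProb
  split_ifs with h
  · rw [LogLinear.prob_congr, div_self hpos.ne']
    intro ω' hw
    refine ⟨fun h' => h'.2, fun h' => ⟨?_, h'⟩⟩
    rintro ⟨_, rfl⟩
    exact ((eq_F_of_mem_sufficient hM h'.2 hw).trans (hF ω' h'.1)).trans h.symm
  · rw [LogLinear.prob_congr (B := ∅), LogLinear.prob_empty, zero_div]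
    intro ω' hw
    refine iff_of_false (fun h' => h ?_) id
    rw [← hF ω' h'.2.1, ← eq_F_of_mem_sufficient hM h'.2.2 hw]
    exact (h'.1 ⟨Sum.inr x, rfl⟩).symm

/-! ### Demonstrations at all nodes and the distribution of the network -/

theorem bochman_components_disjoint_pure (hM : M.Acyclic) {A : Set (U ⊕ V)} :
    A ∈ (M.bochman R).components ∧ Disjoint A (M.bochman R).pure ↔ ∃ x, A = {Sum.inr x} := by
  rw [bochman_components hM, bochman_pure]
  constructor
  · rintro ⟨⟨e | x, rfl⟩, h⟩
    · simp at h
    · exact ⟨x, rfl⟩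
  · rintro ⟨x, rfl⟩
    exact ⟨⟨_, rfl⟩, by simp⟩

theorem bochman_providesDemonstrations (hM : M.Acyclic) :
    (M.bochman R).ProvidesDemonstrations where
  sum_eq_one A hA hd pa := by
    obtain ⟨x, rfl⟩ := (bochman_components_disjoint_pure hM).1 ⟨hA, hd⟩
    exact LogLinear.sum_condProb_assign _ (bochman_demo_condition_pos hM x pa).ne'
  pure_not_effect S hS := by
    obtain ⟨x, φ, -, rfl⟩ := (mem_bochman_explanatory R).1 hS
    simp [bochman_pure]
  covered p := Or.inr ⟨⟨p, false⟩, Or.inr ⟨p, rfl⟩, rfl⟩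

theorem bochman_nodes (hM : M.Acyclic) [DecidableEq (Set (U ⊕ V))] :
    (M.bochman R).nodes =
      insert (M.bochman R).pure (Finset.univ.image fun x : V => ({Sum.inr x} : Set (U ⊕ V))) := by
  ext A
  simp only [CausalSystem.nodes, Finset.mem_insert, Finset.mem_filter, Finset.mem_univ, true_and,
    bochman_components_disjoint_pure hM, Finset.mem_image, eq_comm]

theorem singleton_inr_ne_bochman_pure (x : V) :
    ({Sum.inr x} : Set (U ⊕ V)) ≠ (M.bochman R).pure := by
  intro h
  have : Sum.inr x ∈ (M.bochman R).pure := h ▸ rfl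
  simp [bochman_pure] at this

theorem bochman_worldProb (hM : M.Acyclic) (h : (M.bochman R).ProvidesDemonstrations)
    (ω : World (U ⊕ V)) : h.network.worldProb ω = M.worldProb ω := by
  classical
  have hpure : h.network.param (M.bochman R).pure (fun p => ω p) (fun p => ω p) =
      (M.dist fun e => ω (Sum.inl e)).toReal := by
    change dite _ _ _ = _
    rw [dif_pos rfl, ← bochman_science_prob R]
    congr 1
    ext ω'
    simp only [assign, bochman_pure, Set.mem_ofPred_eq, Subtype.forall, Set.forall_mem_range,
      funext_iff]
  have hnode : ∀ x : V, h.network.param {Sum.inr x} (fun p => ω p) (fun p => ω p) =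
      if ω (Sum.inr x) = M.F x (fun y => ω (Sum.inr y)) (fun e => ω (Sum.inl e))
        then 1 else 0 := by
    intro x
    rw [← bochman_demoProb (R := R) hM]
    change dite _ _ _ = _
    rw [dif_neg (singleton_inr_ne_bochman_pure x)]
  have hnodes : h.network.nodes = _ := bochman_nodes hM
  unfold BayesianNetwork.worldProb
  rw [Finset.prod_congr hnodes fun _ _ => rfl, Finset.prod_insert, Finset.prod_image, hpure]
  -- The product of the indicators of the structural equations is the indicator of being a solution.
  · simp only [hnode, Finset.prod_ite_zero, Finset.prod_const_one, Finset.mem_univ, true_imp_iff,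
      mul_ite, mul_one, mul_zero]
    exact if_congr Iff.rfl rfl rfl
  · intro x _ y _ hxy
    exact Sum.inr.inj (Set.singleton_injective hxy)
  · intro hm
    obtain ⟨x, -, hx⟩ := Finset.mem_image.1 hm
    exact singleton_inr_ne_bochman_pure x hx

theorem bochman_network_prob (hM : M.Acyclic) (h : (M.bochman R).ProvidesDemonstrations)
    (A : Set (World (U ⊕ V))) : h.network.prob A = M.prob A := by
  unfold BayesianNetwork.prob ProbCausalModel.prob
  simp only [bochman_worldProb hM]
  congr!

theorem bochman_network_condProb_univ (hM : M.Acyclic)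
    (h : (M.bochman R).ProvidesDemonstrations) (A : Set (World (U ⊕ V))) :
    h.network.condProb A Set.univ = M.prob A := by
  rw [BayesianNetwork.condProb, bochman_network_prob hM, bochman_network_prob hM, prob_univ hM,
    div_one, Set.inter_univ]

theorem bochman_knowsWhy (hM : M.Acyclic) (A : Set (World (U ⊕ V))) :
    (M.bochman R).KnowsWhy A (M.prob A) := by
  have h : (M.bochman R).ProvidesDemonstrations := bochman_providesDemonstrations hM
  have h₁ : h.causalProb A = M.prob A := by
    rw [← bochman_network_condProb_univ hM h]
    unfold CausalSystem.ProvidesDemonstrations.causalProb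
    congr 1
    simp [bochman]
  have h₂ : h.restrict.causalProb A = M.prob A := by
    rw [← bochman_network_condProb_univ hM h]
    -- The network does not depend on the observations, so the restricted system has the same one.
    change h.network.condProb A _ = _
    congr 1
    simp [bochman, CausalSystem.restrict]
  exact ⟨h, h₁.trans h₂.symm, h₁⟩

end Structure

end ProbCausalModel

end MaxEnt

theorem mainTheorem1 {U : Type*} {V : Type*} [Fintype U] [Fintype V]
    (M : MaxEnt.ProbCausalModel U V) (hM : M.Acyclic) (R : M.Presentation) :
    (M.bochman R).ProvidesDemonstrations ∧
      ∀ φ : MaxEnt.Formula (U ⊕ V), (M.bochman R).KnowsWhy φ.event (M.prob φ.event) :=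
  ⟨MaxEnt.ProbCausalModel.bochman_providesDemonstrations hM,
    fun φ => MaxEnt.ProbCausalModel.bochman_knowsWhy hM φ.event⟩
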